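/- Let $n\ge 3$. Let $R=\mathbb{Q}[a,b,c,(abc)^{-1}]$, $x=b+c$, $y=bc$, $S=R[x^{-1}]$ and $S^{\dagger\dagger}=S/(a^2-1,\,y-1)$. Let $B_n$ be the braid group on $n$ strands with Artin generators $s_1,\dots,s_{n-1}$, and let $H_n$ be the cubic Hecke algebra, i.e. the quotient of the group algebra $RB_n$ by the relations $(s_i-a)(s_i-b)(s_i-c)=0$ for $1\le i\le n-1$. Let $\widetilde{BMW}_n$ be the quotient of $H_n$ by the two-sided ideal generated by the elements $$\mathcal R_i=-y\,s_is_{i+1}^{-1}s_i+y^2 s_{i+1}^{-1}s_is_{i+1}^{-1}-s_is_{i+1}s_i-xy^2s_{i+1}^{-2}+x s_i^2+y^3s_{i+1}^{-1}s_i^{-1}s_{i+1}^{-1}\qquad(1\le i\le n-2),$$ and put $BMW_n^{\dagger\dagger}=\widetilde{BMW}_n\otimes_R S^{\dagger\dagger}$. Let $A=\mathbb{Q}[a,x,x^{-1}]/(a^2-1)$, and let $F_n$ be the unital associative $A$-algebra generated by invertible elements $s_1,\dots,s_{n-1}$ and elements $e_1,\dots,e_{n-1}$, $C$, subject to the relations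 1. $s_is_{i+1}s_i=s_{i+1}s_is_{i+1}$, and $s_is_j=s_js_i$ for $|i-j|\ge 2$; 2. $(s_i-a)(s_i^2-xs_i+1)=0$; 3. $e_i=a\left(\frac{s_i^{-1}+s_i}{x}-1\right)$; 4. $s_ie_i=ae_i$; 5. $e_is_je_i=e_i+C$ and $e_is_j^{-1}e_i=e_i+C$ whenever $|i-j|=1$; 6. $s_iC=Cs_i=aC$. Regard $S^{\dagger\dagger}$ as an $A$-algebra via $a\mapsto a$, $x\mapsto b+c$. Then there is a unique morphism of $S^{\dagger\dagger}$-algebras $$BMW_n^{\dagger\dagger}\longrightarrow F_n\otimes_A S^{\dagger\dagger},\qquad s_i\mapsto s_i\quad(1\le i\le n-1),$$ and it becomes an isomorphism after tensoring over $S^{\dagger\dagger}$ with $S^{\dagger\dagger}[(x+2a)^{-1}]$. -/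

import Mathlib

open scoped TensorProduct

namespace CubicBMW

noncomputable section

/-! ### Base rings -/

/-- The monomial `abc` of `ℚ[a, b, c]`, with `a`, `b`, `c` the variables of index `0`, `1`, `2`. -/
abbrev abc : MvPolynomial (Fin 3) ℚ := MvPolynomial.X 0 * MvPolynomial.X 1 * MvPolynomial.X 2

/-- `R = ℚ[a, b, c, (abc)⁻¹]`. -/
def R : Type := Localization.Away abc

instance : CommRing R := inferInstanceAs (CommRing (Localization.Away abc))

instance : Algebra (MvPolynomial (Fin 3) ℚ) R :=
  inferInstanceAs (Algebra (MvPolynomial (Fin 3) ℚ) (Localization.Away abc))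

instance : IsLocalization.Away abc R :=
  inferInstanceAs (IsLocalization.Away abc (Localization.Away abc))

/-- The parameter `a` of `R`. -/
def Ra : R := algebraMap (MvPolynomial (Fin 3) ℚ) R (MvPolynomial.X 0)

/-- The parameter `b` of `R`. -/
def Rb : R := algebraMap (MvPolynomial (Fin 3) ℚ) R (MvPolynomial.X 1)

/-- The parameter `c` of `R`. -/
def Rc : R := algebraMap (MvPolynomial (Fin 3) ℚ) R (MvPolynomial.X 2)

/-- `S = R[(b + c)⁻¹]`. -/
def S : Type := Localization.Away (Rb + Rc)

instance : CommRing S := inferInstanceAs (CommRing (Localization.Away (Rb + Rc)))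

instance : Algebra R S := inferInstanceAs (Algebra R (Localization.Away (Rb + Rc)))

instance : IsLocalization.Away (Rb + Rc) S :=
  inferInstanceAs (IsLocalization.Away (Rb + Rc) (Localization.Away (Rb + Rc)))

/-- The ideal `(a² - 1, y - 1)` of `S`, where `y = bc`. -/
def ddIdeal : Ideal S :=
  Ideal.span {algebraMap R S (Ra ^ 2 - 1), algebraMap R S (Rb * Rc - 1)}

/-- `S^{††} = S / (a² - 1, y - 1)`. -/
def Sdd : Type := S ⧸ ddIdeal

instance : CommRing Sdd := inferInstanceAs (CommRing (S ⧸ ddIdeal))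

/-- The quotient map `S → S^{††}`. -/
def mkSdd : S →+* Sdd := Ideal.Quotient.mk ddIdeal

/-- `S^{††}` is an `R`-algebra through `R → S → S^{††}`. -/
instance : Algebra R Sdd := (mkSdd.comp (algebraMap R S)).toAlgebra

/-- The image of `a` in `S^{††}`. -/
def ddA : Sdd := algebraMap R Sdd Ra

/-- The image of `x = b + c` in `S^{††}`. -/
def ddX : Sdd := algebraMap R Sdd (Rb + Rc)

/-- `S^{††}[(x + 2a)⁻¹]`. -/
def SddLoc : Type := Localization.Away (ddX + 2 * ddA)

instance : CommRing SddLoc := inferInstanceAs (CommRing (Localization.Away (ddX + 2 * ddA)))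

instance : Algebra Sdd SddLoc :=
  inferInstanceAs (Algebra Sdd (Localization.Away (ddX + 2 * ddA)))

instance : IsLocalization.Away (ddX + 2 * ddA) SddLoc :=
  inferInstanceAs (IsLocalization.Away (ddX + 2 * ddA) (Localization.Away (ddX + 2 * ddA)))

/-- The variable `x` of `ℚ[a, x]`, with `a` and `x` the variables of index `0` and `1`. -/
abbrev xVar : MvPolynomial (Fin 2) ℚ := MvPolynomial.X 1

/-- `ℚ[a, x, x⁻¹]`. -/
def A₀ : Type := Localization.Away xVar

instance : CommRing A₀ := inferInstanceAs (CommRing (Localization.Away xVar))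

instance : Algebra (MvPolynomial (Fin 2) ℚ) A₀ :=
  inferInstanceAs (Algebra (MvPolynomial (Fin 2) ℚ) (Localization.Away xVar))

instance : IsLocalization.Away xVar A₀ :=
  inferInstanceAs (IsLocalization.Away xVar (Localization.Away xVar))

/-- The ideal `(a² - 1)` of `ℚ[a, x, x⁻¹]`. -/
def aIdeal : Ideal A₀ :=
  Ideal.span {algebraMap (MvPolynomial (Fin 2) ℚ) A₀ (MvPolynomial.X 0 ^ 2 - 1)}

/-- `A = ℚ[a, x, x⁻¹] / (a² - 1)`. -/
def A : Type := A₀ ⧸ aIdeal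

instance : CommRing A := inferInstanceAs (CommRing (A₀ ⧸ aIdeal))

/-- The quotient map `ℚ[a, x, x⁻¹] → A`. -/
def mkA : A₀ →+* A := Ideal.Quotient.mk aIdeal

/-- The element `a` of `A`. -/
def Aa : A := mkA (algebraMap (MvPolynomial (Fin 2) ℚ) A₀ (MvPolynomial.X 0))

/-- The element `x` of `A`. -/
def Ax : A := mkA (algebraMap (MvPolynomial (Fin 2) ℚ) A₀ xVar)

/-- The element `x⁻¹` of `A`. -/
def AxInv : A :=
  mkA (IsLocalization.Away.invSelf xVar)

theorem Ax_mul_AxInv : Ax * AxInv = 1 := by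
  rw [Ax, AxInv, ← map_mul, IsLocalization.Away.mul_invSelf, map_one]

theorem ddA_sq : ddA ^ 2 = 1 := by
  have h : mkSdd (algebraMap R S (Ra ^ 2 - 1)) = 0 :=
    Ideal.Quotient.eq_zero_iff_mem.mpr (Ideal.subset_span (by simp))
  have h2 : algebraMap R Sdd (Ra ^ 2 - 1) = 0 := h
  rw [map_sub, map_pow, map_one] at h2
  exact sub_eq_zero.mp h2

theorem isUnit_ddX : IsUnit ddX :=
  (IsLocalization.Away.algebraMap_isUnit (S := S) (Rb + Rc)).map mkSdd

/-- The morphism `ℚ[a, x] → S^{††}` with `a ↦ a` and `x ↦ b + c`. -/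
def polyToSdd : MvPolynomial (Fin 2) ℚ →+* Sdd :=
  MvPolynomial.eval₂Hom ((algebraMap R Sdd).comp
    ((algebraMap (MvPolynomial (Fin 3) ℚ) R).comp MvPolynomial.C)) ![ddA, ddX]

theorem polyToSdd_X0 : polyToSdd (MvPolynomial.X 0) = ddA := by
  simp [polyToSdd]

theorem polyToSdd_X1 : polyToSdd xVar = ddX := by
  simp [polyToSdd]

theorem isUnit_polyToSdd_X1 : IsUnit (polyToSdd xVar) := by
  rw [polyToSdd_X1]; exact isUnit_ddX

/-- The extension of `polyToSdd` to `ℚ[a, x, x⁻¹] → S^{††}`. -/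
def A₀ToSdd : A₀ →+* Sdd :=
  IsLocalization.Away.lift xVar isUnit_polyToSdd_X1

theorem A₀ToSdd_algebraMap (p : MvPolynomial (Fin 2) ℚ) :
    A₀ToSdd (algebraMap (MvPolynomial (Fin 2) ℚ) A₀ p) = polyToSdd p :=
  IsLocalization.Away.lift_eq _ _ _

theorem A₀ToSdd_eq_zero (p : A₀) (hp : p ∈ aIdeal) : A₀ToSdd p = 0 := by
  have hle : aIdeal ≤ RingHom.ker A₀ToSdd := by
    refine Ideal.span_le.mpr ?_
    rintro _ rfl
    change A₀ToSdd _ = 0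
    rw [A₀ToSdd_algebraMap, map_sub, map_pow, map_one, polyToSdd_X0, ddA_sq, sub_self]
  exact hle hp

/-- The morphism `A → S^{††}` with `a ↦ a` and `x ↦ b + c`. -/
def AToSdd : A →+* Sdd := Ideal.Quotient.lift aIdeal A₀ToSdd A₀ToSdd_eq_zero

/-- `S^{††}` is an `A`-algebra through `a ↦ a` and `x ↦ b + c`. -/
instance algebraASdd : Algebra A Sdd := AToSdd.toAlgebra

/-! ### The braid group and the cubic Hecke algebra

The generators of the braid group on `n` strands are indexed by `Fin (n - 1)`, so that the index
`i : Fin (n - 1)` stands for the `(i + 1)`-st Artin generator. -/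

/-- The Artin relations on `n - 1` generators, as words that are to be trivial. -/
inductive BraidRel (n : ℕ) : FreeGroup (Fin (n - 1)) → Prop
  | braid (i j : Fin (n - 1)) (h : (j : ℕ) = i + 1) :
      BraidRel n (FreeGroup.of i * FreeGroup.of j * FreeGroup.of i *
        (FreeGroup.of j * FreeGroup.of i * FreeGroup.of j)⁻¹)
  | comm (i j : Fin (n - 1)) (h : (i : ℕ) + 2 ≤ j) :
      BraidRel n (FreeGroup.of i * FreeGroup.of j * (FreeGroup.of j * FreeGroup.of i)⁻¹)

/-- The braid group `B_n` on `n` strands. -/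
abbrev Braid (n : ℕ) : Type := PresentedGroup {w | BraidRel n w}

/-- The Artin generators of `B_n`. -/
def σ {n : ℕ} (i : Fin (n - 1)) : Braid n := PresentedGroup.of i

/-- A braid, seen in the group algebra `R B_n`. -/
def ofBraid {n : ℕ} (g : Braid n) : MonoidAlgebra R (Braid n) := MonoidAlgebra.of R (Braid n) g

/-- The cubic relations `(s_i - a)(s_i - b)(s_i - c) = 0` in `R B_n`. -/
inductive CubicRel (n : ℕ) : MonoidAlgebra R (Braid n) → MonoidAlgebra R (Braid n) → Prop
  | cubic (i : Fin (n - 1)) :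
      CubicRel n ((ofBraid (σ i) - algebraMap R _ Ra) * (ofBraid (σ i) - algebraMap R _ Rb) *
        (ofBraid (σ i) - algebraMap R _ Rc)) 0

/-- The cubic Hecke algebra `H_n`. -/
abbrev H (n : ℕ) : Type := RingQuot (CubicRel n)

/-- The image of a braid in `H_n`. -/
def H.braid {n : ℕ} (g : Braid n) : H n := RingQuot.mkAlgHom R (CubicRel n) (ofBraid g)

/-- The six-term element `ℛ` attached to `s = s_i` and `t = s_{i+1}`:
`-bc s t⁻¹ s + (bc)² t⁻¹ s t⁻¹ - s t s - (b+c)(bc)² t⁻² + (b+c) s² + (bc)³ t⁻¹ s⁻¹ t⁻¹`. -/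
def sixTerm {n : ℕ} (s t : Braid n) : H n :=
  -((Rb * Rc) • H.braid (s * t⁻¹ * s)) + (Rb * Rc) ^ 2 • H.braid (t⁻¹ * s * t⁻¹)
    - H.braid (s * t * s) - ((Rb + Rc) * (Rb * Rc) ^ 2) • H.braid (t⁻¹ * t⁻¹)
    + (Rb + Rc) • H.braid (s * s) + (Rb * Rc) ^ 3 • H.braid (t⁻¹ * s⁻¹ * t⁻¹)

/-- The relations `ℛ_i = 0` in `H_n`, for any two consecutive generators. -/
inductive SixTermRel (n : ℕ) : H n → H n → Prop
  | six (i j : Fin (n - 1)) (h : (j : ℕ) = i + 1) : SixTermRel n (sixTerm (σ i) (σ j)) 0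

/-- The algebra `\widetilde{BMW}_n`, the quotient of `H_n` by the ideal generated by the `ℛ_i`. -/
abbrev BMWt (n : ℕ) : Type := RingQuot (SixTermRel n)

/-- The generators `s_i` of `\widetilde{BMW}_n`. -/
def BMWt.s {n : ℕ} (i : Fin (n - 1)) : BMWt n :=
  RingQuot.mkAlgHom R (SixTermRel n) (H.braid (σ i))

/-- `BMW_n^{††} = \widetilde{BMW}_n ⊗_R S^{††}`, as an `S^{††}`-algebra. -/
abbrev BMWdd (n : ℕ) : Type := Sdd ⊗[R] BMWt n

/-! ### The algebra `F_n` -/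

/-- The generators of `F_n`; `sinv i` is the inverse of `s i`. -/
inductive FGen (n : ℕ) : Type
  | s (i : Fin (n - 1))
  | sinv (i : Fin (n - 1))
  | e (i : Fin (n - 1))
  | C

/-- `s_i` in the free algebra. -/
abbrev fs {n : ℕ} (i : Fin (n - 1)) : FreeAlgebra A (FGen n) := FreeAlgebra.ι A (FGen.s i)

/-- `s_i⁻¹` in the free algebra. -/
abbrev fsi {n : ℕ} (i : Fin (n - 1)) : FreeAlgebra A (FGen n) := FreeAlgebra.ι A (FGen.sinv i)

/-- `e_i` in the free algebra. -/
abbrev fe {n : ℕ} (i : Fin (n - 1)) : FreeAlgebra A (FGen n) := FreeAlgebra.ι A (FGen.e i)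

/-- `C` in the free algebra. -/
abbrev fC (n : ℕ) : FreeAlgebra A (FGen n) := FreeAlgebra.ι A FGen.C

/-- The defining relations of `F_n`. -/
inductive FRel (n : ℕ) : FreeAlgebra A (FGen n) → FreeAlgebra A (FGen n) → Prop
  | mul_inv (i : Fin (n - 1)) : FRel n (fs i * fsi i) 1
  | inv_mul (i : Fin (n - 1)) : FRel n (fsi i * fs i) 1
  | braid (i j : Fin (n - 1)) (h : (j : ℕ) = i + 1) :
      FRel n (fs i * fs j * fs i) (fs j * fs i * fs j)
  | comm (i j : Fin (n - 1)) (h : (i : ℕ) + 2 ≤ j) : FRel n (fs i * fs j) (fs j * fs i)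
  | cubic (i : Fin (n - 1)) :
      FRel n ((fs i - algebraMap A _ Aa) * (fs i ^ 2 - Ax • fs i + 1)) 0
  | e_def (i : Fin (n - 1)) : FRel n (fe i) (Aa • (AxInv • (fsi i + fs i) - 1))
  | s_mul_e (i : Fin (n - 1)) : FRel n (fs i * fe i) (Aa • fe i)
  | e_s_e (i j : Fin (n - 1)) (h : (j : ℕ) = i + 1 ∨ (i : ℕ) = j + 1) :
      FRel n (fe i * fs j * fe i) (fe i + fC n)
  | e_sinv_e (i j : Fin (n - 1)) (h : (j : ℕ) = i + 1 ∨ (i : ℕ) = j + 1) :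
      FRel n (fe i * fsi j * fe i) (fe i + fC n)
  | s_mul_C (i : Fin (n - 1)) : FRel n (fs i * fC n) (Aa • fC n)
  | C_mul_s (i : Fin (n - 1)) : FRel n (fC n * fs i) (Aa • fC n)

/-- The `A`-algebra `F_n`. -/
abbrev F (n : ℕ) : Type := RingQuot (FRel n)

/-- The generators `s_i` of `F_n`. -/
def F.s {n : ℕ} (i : Fin (n - 1)) : F n := RingQuot.mkAlgHom A (FRel n) (fs i)

/-- `F_n ⊗_A S^{††}`, as an `S^{††}`-algebra. -/
abbrev Fdd (n : ℕ) : Type := Sdd ⊗[A] F n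

end

end CubicBMW

/-! Both algebras are generated by the units `s_i`, so the question is whether the two sets of
relations on a family of units imply each other. Replacing `s` by `a s`, `x` by `a x`, `e` by `a e`
and `C` by `a C` reduces everything to `a = 1`, since `a² = 1`. The cubic relation then says that `e
= (s + s⁻¹)/x - 1` is fixed by `s` on both sides, and it gives `e² = (2/x - 1) e`. Because `bc = 1`,
the six-term element is, up to sign and a unit, the difference of the two sides of `t⁻¹ e t⁻¹ = s f
s`, where `e`, `f` belong to the adjacent generators `s`, `t`.

On three strands this equation is equivalent to the relations of `F_n`, with no further
localization. `Adj.six` proves one direction, which already yields the morphism out of `BMW_n^{††}`.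
`Adj.of_six` proves the other: the equation forces `v = e t e - e` to be fixed by `s` and `t` on
both sides, and `v` is unchanged when `s` and `t` are exchanged.

What remains is that the elements `v` of different adjacent pairs coincide, so that a single `C`
serves all of them. This concerns three consecutive generators `p`, `q`, `r`, with `v` attached to
`(p, q)` and `u` to `(q, r)`. `four_vg` gives `v g = e u` after division by `x + 2`, the only use of
the inverse of `x + 2a`. From it follows `v r = v` (`four_v_r`), and conjugation by `r q p`, which
carries one pair to the other, gives `v = u` (`four_eq`). The two universal properties then provide
mutually inverse maps after localization. -/

namespace CubicBMW

/-! ### One generator and its quasi-idempotent, normalized to `a = 1`. -/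

section Skein

variable {K B : Type*} [CommRing K] [Ring B] [Algebra K B]

/-- An invertible element `s` with inverse `S`, together with the multiple `e` of the idempotent
on which `s` acts as `1`, normalized by the skein relation `s + S = x (1 + e)`. -/
structure Gen (x m : K) (s S e : B) : Prop where
  mul_inv : s * S = 1
  inv_mul : S * s = 1
  skein : S = x • (1 : B) + x • e - s
  mul_e : s * e = e
  e_mul : e * s = e
  e_e : e * e = m • e - e

namespace Gen

variable {x m : K} {s S e : B}

theorem inv_e (h : Gen x m s S e) : S * e = e := by
  calc S * e = S * (s * e) := by rw [h.mul_e]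
    _ = e := by rw [← mul_assoc, h.inv_mul, one_mul]

theorem e_inv (h : Gen x m s S e) : e * S = e := by
  calc e * S = e * s * S := by rw [h.e_mul]
    _ = e := by rw [mul_assoc, h.mul_inv, mul_one]

theorem inv (h : Gen x m s S e) : Gen x m S s e :=
  ⟨h.inv_mul, h.mul_inv, by rw [h.skein]; abel, h.inv_e, h.e_inv, h.e_e⟩

/-- The relations are symmetric under reversal of products, so each left-handed identity yields its
mirror image in the opposite algebra. -/
theorem op (h : Gen x m s S e) :
    Gen x m (MulOpposite.op s) (MulOpposite.op S) (MulOpposite.op e) :=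
  ⟨congrArg MulOpposite.op h.inv_mul, congrArg MulOpposite.op h.mul_inv,
    congrArg MulOpposite.op h.skein, congrArg MulOpposite.op h.e_mul,
    congrArg MulOpposite.op h.mul_e, congrArg MulOpposite.op h.e_e⟩

theorem sq (h : Gen x m s S e) : s * s = x • s + x • e - 1 := by
  have := congrArg (s * ·) h.skein
  simp only [h.mul_inv, mul_sub, mul_add, mul_smul_comm, mul_one, h.mul_e] at this
  rw [this]; abel

/-- An element intertwining two generators intertwines their idempotents. -/
theorem conj {η : K} (hx : η * x = 1) {t T f g : B} (hs : Gen x m s S e) (ht : Gen x m t T f)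
    (hg : g * s = t * g) : g * e = f * g := by
  have h1 : g * S = T * g := by
    calc g * S = T * (t * g) * S := by rw [← mul_assoc T, ht.inv_mul, one_mul]
      _ = T * g := by rw [← hg, mul_assoc, mul_assoc, hs.mul_inv, mul_one]
  have h2 : x • (g * e) = x • (f * g) := by
    rw [hs.skein, ht.skein] at h1
    simp only [mul_sub, mul_add, sub_mul, add_mul, mul_smul_comm, smul_mul_assoc, mul_one,
      one_mul, hg] at h1
    simpa using h1
  calc g * e = η • x • (g * e) := by rw [smul_smul, hx, one_smul]
    _ = f * g := by rw [h2, smul_smul, hx, one_smul]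

/-- On vectors fixed by `s`, the idempotent acts as a scalar. -/
theorem e_mul_of_fixed {η : K} (hx : η * x = 1) (hm : x * m = 2) (h : Gen x m s S e) {w : B}
    (hw : s * w = w) : e * w = m • w - w := by
  have hS : S * w = w := by
    calc S * w = S * (s * w) := by rw [hw]
      _ = w := by rw [← mul_assoc, h.inv_mul, one_mul]
  have h1 := congrArg (· * w) h.skein
  simp only [hS, sub_mul, add_mul, smul_mul_assoc, one_mul, hw] at h1
  have h2 : x • (e * w) = x • (m • w - w) := by
    rw [smul_sub, smul_smul, hm, two_smul]
    linear_combination (norm := abel) h1.symm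
  calc e * w = η • x • (e * w) := by rw [smul_smul, hx, one_smul]
    _ = _ := by rw [h2, smul_smul, hx, one_smul]

theorem mul_e_of_fixed {η : K} (hx : η * x = 1) (hm : x * m = 2) (h : Gen x m s S e) {w : B}
    (hw : w * s = w) : w * e = m • w - w :=
  congrArg MulOpposite.unop (h.op.e_mul_of_fixed hx hm (congrArg MulOpposite.op hw))

end Gen

/-! ### Two adjacent generators: the six-term relation against the relations of `F_n`. -/

/-- Two braided generators whose idempotents satisfy the relations of `F_n`, with `a = 1`. -/
structure Adj (x m : K) (s S e t T f v : B) : Prop where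
  left : Gen x m s S e
  right : Gen x m t T f
  braid : s * t * s = t * s * t
  e_t_e : e * t * e = e + v
  e_T_e : e * T * e = e + v
  f_s_f : f * s * f = f + v
  f_S_f : f * S * f = f + v
  s_v : s * v = v
  v_s : v * s = v
  t_v : t * v = v
  v_t : v * t = v

namespace Adj

variable {x m η : K} {s S e t T f v : B}

theorem swap (h : Adj x m s S e t T f v) : Adj x m t T f s S e v :=
  ⟨h.right, h.left, h.braid.symm, h.f_s_f, h.f_S_f, h.e_t_e, h.e_T_e, h.t_v, h.v_t, h.s_v, h.v_s⟩

theorem S_v (h : Adj x m s S e t T f v) : S * v = v := by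
  calc S * v = S * (s * v) := by rw [h.s_v]
    _ = v := by rw [← mul_assoc, h.left.inv_mul, one_mul]

theorem v_S (h : Adj x m s S e t T f v) : v * S = v := by
  calc v * S = v * s * S := by rw [h.v_s]
    _ = v := by rw [mul_assoc, h.left.mul_inv, mul_one]

theorem op (h : Adj x m s S e t T f v) :
    Adj x m (MulOpposite.op s) (MulOpposite.op S) (MulOpposite.op e) (MulOpposite.op t)
      (MulOpposite.op T) (MulOpposite.op f) (MulOpposite.op v) where
  left := h.left.op
  right := h.right.op
  braid := congrArg MulOpposite.op ((mul_assoc s t s).symm.trans (h.braid.trans (mul_assoc t s t)))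
  e_t_e := congrArg MulOpposite.op ((mul_assoc e t e).symm.trans h.e_t_e)
  e_T_e := congrArg MulOpposite.op ((mul_assoc e T e).symm.trans h.e_T_e)
  f_s_f := congrArg MulOpposite.op ((mul_assoc f s f).symm.trans h.f_s_f)
  f_S_f := congrArg MulOpposite.op ((mul_assoc f S f).symm.trans h.f_S_f)
  s_v := congrArg MulOpposite.op h.v_s
  v_s := congrArg MulOpposite.op h.s_v
  t_v := congrArg MulOpposite.op h.v_t
  v_t := congrArg MulOpposite.op h.t_v

/-- Inverses of braided units are braided. -/
theorem _root_.CubicBMW.braid_inv {s S t T : B} (hs : s * S = 1) (hs' : S * s = 1) (ht : t * T = 1)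
    (ht' : T * t = 1) (h : s * t * s = t * s * t) : S * T * S = T * S * T := by
  let u : Bˣ := ⟨s, S, hs, hs'⟩
  let w : Bˣ := ⟨t, T, ht, ht'⟩
  have h1 : u * w * u = w * u * w := Units.ext h
  have h2 : u⁻¹ * w⁻¹ * u⁻¹ = w⁻¹ * u⁻¹ * w⁻¹ := by
    have := congrArg (·⁻¹) h1
    simpa [mul_assoc] using this
  exact congrArg Units.val h2

theorem inv (h : Adj x m s S e t T f v) : Adj x m S s e T t f v where
  left := h.left.inv
  right := h.right.inv
  braid := braid_inv h.left.mul_inv h.left.inv_mul h.right.mul_inv h.right.inv_mul h.braid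
  e_t_e := h.e_T_e
  e_T_e := h.e_t_e
  f_s_f := h.f_S_f
  f_S_f := h.f_s_f
  s_v := h.S_v
  v_s := h.v_S
  t_v := h.swap.S_v
  v_t := h.swap.v_S

theorem st_e (hx : η * x = 1) (h : Adj x m s S e t T f v) : s * t * e = f * (s * t) :=
  Gen.conj hx h.left h.right (h.braid.trans (mul_assoc t s t))

/-- Since `T S` intertwines `f` and `e`, it sends `f e` to `e T e = e + v`; applying `s t`, which
fixes `v`, gives the formula. -/
theorem s_t_e (hx : η * x = 1) (h : Adj x m s S e t T f v) : s * t * e = f * e - v := by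
  have h1 : T * S * f = e * (T * S) := h.inv.swap.st_e hx
  have h2 : T * S * (f * e) = e + v := by
    rw [← mul_assoc, h1, mul_assoc, mul_assoc, h.left.inv_e, ← mul_assoc, h.e_T_e]
  have h3 : s * t * (T * S * (f * e)) = f * e := by
    rw [← mul_assoc, mul_assoc s, ← mul_assoc t, h.right.mul_inv, one_mul, h.left.mul_inv, one_mul]
  rw [← h3, h2, mul_add, mul_assoc s t v, h.t_v, h.s_v, add_sub_cancel_right]

theorem e_t_s (hx : η * x = 1) (h : Adj x m s S e t T f v) : e * t * s = e * f - v :=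
  (mul_assoc e t s).trans (congrArg MulOpposite.unop (h.op.s_t_e hx))

theorem e_f_e (hx : η * x = 1) (h : Adj x m s S e t T f v) (hm : x * m = 2) :
    e * f * e = e + m • v := by
  have h1 : e * f = e * t * s + v := by rw [h.e_t_s hx, sub_add_cancel]
  have h2 : v * e = m • v - v := h.left.mul_e_of_fixed hx hm h.v_s
  rw [h1, add_mul, mul_assoc _ s, h.left.mul_e, h.e_t_e, h2]
  abel

theorem e_f_s (hx : η * x = 1) (h : Adj x m s S e t T f v) :
    e * f * s = x • e + x • (e * f) - e * t + v := by
  have h1 : e * f = e * T * S + v := by rw [h.inv.e_t_s hx, sub_add_cancel]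
  have h2 : e * f * s = e * T + v := by
    rw [h1, add_mul, mul_assoc _ S, h.left.inv_mul, mul_one, h.v_s]
  rw [h2, h.right.skein]
  simp [mul_sub, mul_add]

theorem s_f_e (hx : η * x = 1) (h : Adj x m s S e t T f v) :
    s * (f * e) = x • e + x • (f * e) - t * e + v :=
  congrArg MulOpposite.unop (h.op.e_f_s hx)

/-- The six-term relation, in terms of idempotents. -/
theorem six (hx : η * x = 1) (h : Adj x m s S e t T f v) : T * e * T = s * f * s := by
  -- Here `s t e = f e - v`; in the next two products the quadratic terms cancel and only `e`
  -- survives.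
  have h1 : t * (s * (s * (t * e))) = e := by
    have h2 : s * (t * e) = f * e - v := by rw [← mul_assoc, h.s_t_e hx]
    rw [h2, mul_sub, h.s_f_e hx, h.s_v, add_sub_cancel_right, mul_sub, mul_add, ← mul_assoc t t,
      h.right.sq, mul_smul_comm, mul_smul_comm, ← mul_assoc t f, h.right.mul_e]
    simp only [sub_mul, add_mul, smul_mul_assoc, one_mul]
    abel
  have h3 : T * e = s * (s * (t * e)) := by
    nth_rw 1 [← h1]
    rw [← mul_assoc, h.right.inv_mul, one_mul]
  have h4 : s * (t * e) = f * (s * t) := by rw [← mul_assoc, h.st_e hx]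
  rw [h3, h4]
  simp only [mul_assoc, h.right.mul_inv, mul_one]

/-- The six-term relation is not visibly symmetric in the two generators. Braiding gives `t e T = S
f s`, and the relation itself gives `e t = e T S²`; together they produce the exchanged form. -/
theorem six_swap (hx : η * x = 1) (hs : Gen x m s S e) (ht : Gen x m t T f)
    (hb : s * t * s = t * s * t) (h6 : T * e * T = s * f * s) : S * f * S = t * e * t := by
  have ste : s * t * e = f * (s * t) := Gen.conj hx hs ht (hb.trans (mul_assoc t s t))
  have tsf : t * s * f = e * (t * s) := Gen.conj hx ht hs (hb.symm.trans (mul_assoc s t s))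
  have h1 : t * e * T = S * f * s := by
    calc t * e * T = S * (s * t * e) * T := by
          simp only [← mul_assoc, hs.inv_mul, one_mul]
      _ = S * f * s := by
          rw [ste]
          simp only [mul_assoc, ht.mul_inv, mul_one]
  have h2 : e * t = e * T * S * S := by
    have : t * (T * e * T) = e * t * s * s := by
      rw [mul_assoc e t s, ← tsf, h6]
      simp only [mul_assoc]
    have h3 : e * T = e * t * s * s := by
      rw [← this]
      simp only [← mul_assoc, ht.mul_inv, one_mul]
    rw [h3]
    simp only [mul_assoc]
    rw [← mul_assoc s S, hs.mul_inv, one_mul, hs.mul_inv, mul_one]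
  calc S * f * S = S * f * s * S * S := by rw [mul_assoc _ s, hs.mul_inv, mul_one]
    _ = t * e * t := by rw [← h1, mul_assoc t e t, h2]; simp only [mul_assoc]

/-- The six-term relation for two braided generators implies the relations of `F_n` that are
centred on the first of them. -/
theorem half_of_six (hx : η * x = 1) (hm : x * m = 2) (hs : Gen x m s S e) (ht : Gen x m t T f)
    (hb : s * t * s = t * s * t) (h6 : T * e * T = s * f * s) {v : B} (hv : v = e * t * e - e) :
    e * t * e = e + v ∧ e * T * e = e + v ∧ s * v = v ∧ v * s = v ∧ t * v = v ∧ v * t = v ∧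
      f * e = s * t * e + v ∧ e * f = e * t * s + v := by
  have cancel : ∀ {p q : B}, x • p = x • q → p = q := fun {p q} h => by
    calc p = η • x • p := by rw [smul_smul, hx, one_smul]
      _ = q := by rw [h, smul_smul, hx, one_smul]
  have ste : s * t * e = f * (s * t) := Gen.conj hx hs ht (hb.trans (mul_assoc t s t))
  have tsf : t * s * f = e * (t * s) := Gen.conj hx ht hs (hb.symm.trans (mul_assoc s t s))
  have hl : t * (s * (s * (t * e))) = e := by
    have : t * (T * e * T) * t = e := by
      simp only [← mul_assoc, ht.mul_inv, one_mul]
      rw [mul_assoc, ht.inv_mul, mul_one]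
    rw [← mul_assoc s t e, ste]
    rw [h6] at this
    simpa only [mul_assoc] using this
  have hr : e * t * s * s * t = e := by
    have : t * (T * e * T) * t = e := by
      simp only [← mul_assoc, ht.mul_inv, one_mul]
      rw [mul_assoc, ht.inv_mul, mul_one]
    rw [mul_assoc e t s, ← tsf]
    rw [h6] at this
    simpa only [mul_assoc] using this
  have ete : e * t * e = e + v := by rw [hv]; abel
  have ets_t : e * t * s * t = e * t * s := by
    rw [mul_assoc e t s, mul_assoc e, ← hb]
    simp only [← mul_assoc, hs.e_mul]
  have tst_e : t * (s * (t * e)) = s * (t * e) := by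
    rw [← mul_assoc s t e, ← mul_assoc, ← mul_assoc, ← hb, mul_assoc, hs.mul_e]
  -- Expand `s²` and then `t²` in `e t s² t = e`; every surviving term carries a factor `x`, which
  -- is cancelled.
  have ef : e * f = e * t * s + v * t := by
    apply cancel
    have h1 := hr
    rw [mul_assoc (e * t) s s, hs.sq] at h1
    simp only [mul_sub, mul_add, mul_smul_comm, sub_mul, add_mul, smul_mul_assoc, mul_one,
      ets_t, ete] at h1
    rw [mul_assoc e t t, ht.sq] at h1
    simp only [mul_sub, mul_add, mul_smul_comm, mul_one] at h1
    simp only [smul_add] at h1 ⊢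
    linear_combination (norm := abel) -h1
  have fe : f * e = s * (t * e) + t * v := by
    apply cancel
    have h1 := hl
    rw [← mul_assoc s s, hs.sq] at h1
    have ete' : e * (t * e) = e + v := by rw [← mul_assoc, ete]
    simp only [mul_sub, mul_add, mul_smul_comm, sub_mul, add_mul, smul_mul_assoc, one_mul,
      tst_e, ete'] at h1
    rw [← mul_assoc t t, ht.sq] at h1
    simp only [sub_mul, add_mul, smul_mul_assoc, one_mul] at h1
    simp only [smul_add] at h1 ⊢
    linear_combination (norm := abel) -h1
  -- Right multiplication by `t` fixes both `e f` and `e t s`, so `ef` forces `v t² = v t`.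
  have vt : v * t = v := by
    have h1 := congrArg (· * t) ef
    simp only [add_mul, ets_t] at h1
    rw [mul_assoc e f, ht.e_mul, ef] at h1
    have h2 := congrArg (· * T) (add_left_cancel h1)
    simp only [mul_assoc, ht.mul_inv, mul_one] at h2
    exact h2.symm
  have tv : t * v = v := by
    have h1 := congrArg (t * ·) fe
    simp only [mul_add, tst_e] at h1
    rw [← mul_assoc t f, ht.mul_e, fe] at h1
    have h2 := congrArg (T * ·) (add_left_cancel h1)
    simp only [← mul_assoc, ht.inv_mul, one_mul] at h2
    exact h2.symm
  have sv : s * v = v := by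
    rw [hv, mul_sub, ← mul_assoc, ← mul_assoc, hs.mul_e]
  have vs : v * s = v := by
    rw [hv, sub_mul, mul_assoc _ e, hs.e_mul]
  have v_e : v * e = m • v - v := by
    rw [hv, sub_mul, mul_assoc _ e, hs.e_e, mul_sub, mul_smul_comm, smul_sub]
    abel
  have efe : e * f * e = e + m • v := by
    rw [ef, vt, add_mul, mul_assoc _ s, hs.mul_e, ete, v_e]
    abel
  have eTe : e * T * e = e + v := by
    rw [ht.skein]
    simp only [mul_sub, mul_add, sub_mul, add_mul, mul_smul_comm, smul_mul_assoc, mul_one,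
      hs.e_e, efe, ete, smul_sub, smul_add, smul_smul, hm, two_smul]
    abel
  exact ⟨ete, eTe, sv, vs, tv, vt, by rw [fe, tv, mul_assoc], by rw [ef, vt]⟩

/-- The six-term relation for two braided generators implies the relations of `F_n`. -/
theorem of_six (hx : η * x = 1) (hm : x * m = 2) (hs : Gen x m s S e) (ht : Gen x m t T f)
    (hb : s * t * s = t * s * t) (h6 : T * e * T = s * f * s) :
    Adj x m s S e t T f (e * t * e - e) := by
  obtain ⟨h1, h2, h3, h4, h5, h7, h8, -⟩ := half_of_six hx hm hs ht hb h6 rfl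
  obtain ⟨k1, k2, -, -, -, -, -, k8⟩ :=
    half_of_six hx hm ht hs hb.symm (six_swap hx hs ht hb h6) rfl
  have ste : s * t * e = f * (s * t) := Gen.conj hx hs ht (hb.trans (mul_assoc t s t))
  -- Both halves evaluate `f e`, as `s t e + v` and as `f s t` plus the exchanged `v`; the leading
  -- terms agree by braiding.
  have hv : f * s * f - f = e * t * e - e := by
    rw [h8, ste, mul_assoc f s t] at k8
    exact (add_left_cancel k8).symm
  rw [hv] at k1 k2
  exact ⟨hs, ht, hb, h1, h2, k1, k2, h3, h4, h5, h7⟩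

end Adj

/-! ### Three consecutive generators `p`, `q`, `r`: independence of `C` from the adjacent pair. -/

section FourStrands

variable {x m η θ : K} {p P e q Q f r R g v u : B}

theorem mul_comm_idem (hx : η * x = 1) (h₁ : Gen x m p P e) (h₃ : Gen x m r R g)
    (h : p * r = r * p) : e * r = r * e ∧ p * g = g * p ∧ e * g = g * e := by
  have h1 : r * e = e * r := Gen.conj hx h₁ h₁ h.symm
  exact ⟨h1.symm, Gen.conj hx h₃ h₃ h, Gen.conj hx h₃ h₃ h1.symm⟩

/-- Evaluate `r e q g p` in two ways, absorbing `p` first or `r` first. All terms without `v` or `u`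
cancel. -/
theorem four_aux (hx : η * x = 1) (h₁ : Adj x m p P e q Q f v) (h₂ : Adj x m q Q f r R g u)
    (h : p * r = r * p) : v * g + r * (v * g) = e * u + e * u * p := by
  obtain ⟨er, pg, eg⟩ := mul_comm_idem hx h₁.left h₂.right h
  have a1 : e * q * g * p = e * f * g - v * g := by
    rw [mul_assoc _ g, ← pg, ← mul_assoc, h₁.e_t_s hx, sub_mul]
  have a2 : r * (e * q * g) = e * f * g - e * u := by
    rw [← mul_assoc, ← mul_assoc, ← er, mul_assoc e r, mul_assoc e, h₂.swap.s_t_e hx, mul_sub,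
      mul_assoc]
  have a3 : e * f * g * p = x • (e * g) + x • (e * f * g) - e * q * g + v * g := by
    rw [mul_assoc _ g, ← pg, ← mul_assoc, h₁.e_f_s hx]
    simp only [add_mul, sub_mul, smul_mul_assoc]
  have a4 : r * (e * f * g) = x • (e * g) + x • (e * f * g) - e * q * g + e * u := by
    rw [← mul_assoc, ← mul_assoc, ← er, mul_assoc e r, mul_assoc e, mul_assoc r,
      h₂.swap.s_f_e hx]
    simp only [mul_add, mul_sub, mul_smul_comm, mul_assoc]
  have a5 : r * (e * q * g * p) = r * (e * q * g) * p := (mul_assoc _ _ _).symm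
  rw [a1, a2, mul_sub, sub_mul, a3, a4] at a5
  linear_combination (norm := abel) -a5

/-- Add `four_aux` to its version for the inverse generators. Since `r + R = x (1 + g)` and `p + P =
x (1 + e)`, the sum reads `(2 + x) v g + x g v g = (2 + x) e u + x e u e`, and the last terms on
each side agree. -/
theorem four_vg (hx : η * x = 1) (hm : x * m = 2) (hθ : θ * (2 + x) = 1)
    (hh : IsUnit (2 : K))
    (h₁ : Adj x m p P e q Q f v) (h₂ : Adj x m q Q f r R g u)
    (h : p * r = r * p) : v * g = e * u := by
  obtain ⟨er, pg, eg⟩ := mul_comm_idem hx h₁.left h₂.right h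
  -- Evaluate `g e f e g = e g f g e` by the formula for `e f e` and by the one for `g f g`; `m` can
  -- be cancelled because `x m = 2` is a unit.
  have gvg : g * (v * g) = e * u * e := by
    have b1 : g * (e * f * e) * g = m • e * g - e * g + m • (e * u * e) := by
      have : g * (e * f * e) * g = e * (g * f * g) * e := by
        simp only [← mul_assoc, ← eg]
        simp only [mul_assoc, ← eg]
      rw [this, h₂.swap.e_f_e hx hm]
      simp only [mul_add, add_mul, mul_smul_comm, smul_mul_assoc]
      rw [mul_assoc e g e, ← eg, ← mul_assoc, h₁.left.e_e]
      simp only [sub_mul, smul_mul_assoc]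
    have b2 : g * (e * f * e) * g = m • e * g - e * g + m • (g * (v * g)) := by
      rw [h₁.e_f_e hx hm]
      simp only [mul_add, add_mul, mul_smul_comm, smul_mul_assoc]
      rw [← eg, mul_assoc e g g, h₂.right.e_e]
      simp only [mul_sub, mul_smul_comm, mul_assoc]
    rw [b1] at b2
    have b3 := add_left_cancel b2
    obtain ⟨c, hc⟩ := hh.exists_left_inv
    have b4 : (c * x) • m • (e * u * e) = (c * x) • m • (g * (v * g)) := by rw [b3]
    rw [smul_smul, smul_smul, mul_assoc, hm, hc, one_smul, one_smul] at b4
    exact b4.symm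
  have c1 := four_aux hx h₁ h₂ h
  have c2 := four_aux (p := P) (r := R) hx h₁.inv h₂.inv (by
    let p' : Bˣ := ⟨p, P, h₁.left.mul_inv, h₁.left.inv_mul⟩
    let r' : Bˣ := ⟨r, R, h₂.right.mul_inv, h₂.right.inv_mul⟩
    have : p' * r' = r' * p' := Units.ext h
    have : p'⁻¹ * r'⁻¹ = r'⁻¹ * p'⁻¹ := by
      rw [← mul_inv_rev, ← mul_inv_rev, this]
    exact congrArg Units.val this)
  rw [h₂.right.skein, h₁.left.skein] at c2
  simp only [sub_mul, add_mul, mul_sub, mul_add, smul_mul_assoc, mul_smul_comm, one_mul, mul_one,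
    gvg] at c2
  have c3 : (2 + x) • (v * g) = (2 + x) • (e * u) := by
    simp only [add_smul, two_smul]
    linear_combination (norm := abel) c1 + c2
  calc v * g = θ • (2 + x) • (v * g) := by rw [smul_smul, hθ, one_smul]
    _ = e * u := by rw [c3, smul_smul, hθ, one_smul]

theorem four_r_vg (hx : η * x = 1) (hm : x * m = 2) (hθ : θ * (2 + x) = 1)
    (hh : IsUnit (2 : K))
    (h₁ : Adj x m p P e q Q f v) (h₂ : Adj x m q Q f r R g u)
    (h : p * r = r * p) : r * (v * g) = v * g := by
  obtain ⟨er, pg, eg⟩ := mul_comm_idem hx h₁.left h₂.right h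
  have h1 := four_aux hx h₁ h₂ h
  rw [← four_vg hx hm hθ hh h₁ h₂ h, mul_assoc v g p, ← pg, ← mul_assoc v p g, h₁.v_s] at h1
  exact add_left_cancel h1

theorem four_v_r (hx : η * x = 1) (hm : x * m = 2) (hθ : θ * (2 + x) = 1)
    (hh : IsUnit (2 : K))
    (h₁ : Adj x m p P e q Q f v) (h₂ : Adj x m q Q f r R g u)
    (h : p * r = r * p) : v * r = v := by
  obtain ⟨er, pg, eg⟩ := mul_comm_idem hx h₁.left h₂.right h
  have cancel : ∀ {a b : B}, m • a = m • b → a = b := fun {a b} hab => by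
    obtain ⟨c, hc⟩ := hh.exists_left_inv
    have b4 : (c * x) • m • a = (c * x) • m • b := by rw [hab]
    rwa [smul_smul, smul_smul, mul_assoc, hm, hc, one_smul, one_smul] at b4
  have vg : v * g = e * u := four_vg hx hm hθ hh h₁ h₂ h
  have gv : g * v = u * e := congrArg MulOpposite.unop
    (four_vg hx hm hθ hh h₁.op h₂.op (congrArg MulOpposite.op h.symm))
  have r_w : r * (v * g) = v * g := four_r_vg hx hm hθ hh h₁ h₂ h
  have w'_r : g * v * r = g * v := congrArg MulOpposite.unop
    (four_r_vg hx hm hθ hh h₁.op h₂.op (congrArg MulOpposite.op h.symm))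
  have w_q : v * g * q = v * g := by rw [vg, mul_assoc, h₂.v_s]
  have q_w' : q * (g * v) = g * v := by rw [gv, ← mul_assoc, h₂.s_v]
  have w'_q : g * v * q = g * v := by rw [mul_assoc, h₁.v_t]
  -- Both sides equal `g v g`.
  have w_w' : m • (v * g) - v * g = m • (g * v) - g * v := by
    rw [← h₂.right.e_mul_of_fixed hx hm r_w, ← mul_assoc, h₂.right.mul_e_of_fixed hx hm w'_r]
  have e_w' : e * (g * v) = m • (g * v) - g * v := by
    rw [← mul_assoc, eg, mul_assoc, h₁.left.e_mul_of_fixed hx hm h₁.s_v, mul_sub, mul_smul_comm]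
  have w_e : v * g * e = m • (v * g) - v * g := by
    rw [mul_assoc, ← eg, ← mul_assoc, h₁.left.mul_e_of_fixed hx hm h₁.v_s, sub_mul,
      smul_mul_assoc]
  have w_f : v * g * f = m • (v * g) - v * g := h₂.left.mul_e_of_fixed hx hm w_q
  have w_g : v * g * g = m • (v * g) - v * g := by
    rw [mul_assoc, h₂.right.e_e, mul_sub, mul_smul_comm]
  have vrf : v * r * f = v * g := by
    have h1 : v * q * r * f = v * (q * r * f) := by simp only [mul_assoc]
    have h2 : v * u = v * g * g - v * g := by
      have h3 : v * (g * q * g) = v * g + v * u := by rw [h₂.f_s_f, mul_add]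
      rw [← mul_assoc, ← mul_assoc, w_q] at h3
      rw [h3]; abel
    rw [h₁.v_t, h₂.s_t_e hx, mul_sub, h2, ← mul_assoc, w_f, w_g] at h1
    rw [h1]; abel
  -- Two evaluations of `e f g q e`: reduce `f g q`, or rewrite `e f g` as `e q g p + v g`.
  have key : x • (v * g) - v * r = x • (g * v) - r * v := by
    have k1 : e * f * g * q * e = e * (f * g * q) * e := by simp only [mul_assoc]
    have k2 : e * f * g * q * e = (e * q * g * p + v * g) * q * e := by
      rw [mul_assoc _ g p, ← pg, ← mul_assoc, h₁.e_t_s hx, sub_mul, sub_add_cancel]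
    have k3 : e * q * g * p * q * e = e * (q * g * f) * e - e * q * (g * v) := by
      rw [mul_assoc _ p q, mul_assoc _ _ e, h₁.s_t_e hx, mul_sub]
      simp only [mul_assoc]
    rw [h₂.e_f_s hx] at k1
    rw [add_mul, add_mul, k3, mul_assoc q, h₂.s_f_e hx, mul_assoc e q, q_w', e_w', w_q, w_e, w_w',
      sub_add_cancel, k1] at k2
    have efe := h₁.e_f_e hx hm
    have d1 : e * (f * g) * e = (e + m • v) * g := by
      rw [← efe]; simp only [mul_assoc, eg]
    have d2 : e * (g * f) * e = g * (e + m • v) := by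
      rw [← efe]; simp only [← mul_assoc, eg]
    have d3 : e * (f * r) * e = (e + m • v) * r := by
      rw [← efe]; simp only [mul_assoc, er]
    have d4 : e * (r * f) * e = r * (e + m • v) := by
      rw [← efe]; simp only [← mul_assoc, er]
    simp only [mul_add, mul_sub, add_mul, sub_mul, mul_smul_comm, smul_mul_assoc, d1, d2, d3, d4,
      eg, er, smul_add] at k2
    apply cancel
    rw [smul_sub, smul_sub, smul_comm m x, smul_comm m x]
    linear_combination (norm := abel) k2
  have vrq : v * r * q = v * r := by
    have h1 := congrArg (· * q) key
    simp only [sub_mul, smul_mul_assoc, w_q, w'_q] at h1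
    rw [mul_assoc r, h₁.v_t, ← key] at h1
    exact sub_right_injective h1
  have vr_f : v * r * f = m • (v * r) - v * r := h₂.left.mul_e_of_fixed hx hm vrq
  -- As `v q = v` and `v r q = v r`, the braid relation gives `v r q r = v r`, hence `v r² = v r`.
  have i1 : v * r = x • (v * r) + x • (v * g) - v := by
    have h1 : v * r * q * r = v * r := by
      rw [mul_assoc, mul_assoc v, ← mul_assoc r, ← h₂.braid, ← mul_assoc, ← mul_assoc, h₁.v_t, vrq]
    rw [vrq, mul_assoc, h₂.right.sq] at h1
    simp only [mul_sub, mul_add, mul_smul_comm, mul_one] at h1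
    exact h1.symm
  -- Two values of `v r f` give `2 v r - x v r = x v g`; combined with `i1` this leaves `v r = v`.
  have i2 := congrArg (x • ·) (vr_f.symm.trans vrf)
  simp only [smul_sub, smul_smul, hm, two_smul] at i2
  linear_combination (norm := abel) i2 - i1

theorem four_r_v (hx : η * x = 1) (hm : x * m = 2) (hθ : θ * (2 + x) = 1)
    (hh : IsUnit (2 : K))
    (h₁ : Adj x m p P e q Q f v) (h₂ : Adj x m q Q f r R g u)
    (h : p * r = r * p) : r * v = v :=
  congrArg MulOpposite.unop (four_v_r hx hm hθ hh h₁.op h₂.op (congrArg MulOpposite.op h.symm))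

/-- For three consecutive generators, the elements `C` attached to the two adjacent pairs agree. -/
theorem four_eq (hx : η * x = 1) (hm : x * m = 2) (hθ : θ * (2 + x) = 1)
    (hh : IsUnit (2 : K))
    (h₁ : Adj x m p P e q Q f v) (h₂ : Adj x m q Q f r R g u)
    (h : p * r = r * p) : v = u := by
  have hp : p * u = u := four_r_v hx hm hθ hh h₂.swap h₁.swap h.symm
  -- Conjugation by `r q p` carries the pair `(q, r)` to `(p, q)`, hence `u` to `v`, while `v` and
  -- `u` both absorb `r q p`.
  have c1 : r * q * p * q = p * (r * q * p) := by
    rw [mul_assoc r, mul_assoc r, ← h₁.braid]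
    simp only [← mul_assoc, h]
  have c2 : r * q * p * r = q * (r * q * p) := by
    simp only [← mul_assoc]
    rw [h₂.braid, mul_assoc _ p, h, ← mul_assoc]
  have c3 : r * q * p * f = e * (r * q * p) := Gen.conj hx h₁.right h₁.left c1
  have c4 : r * q * p * u = v * (r * q * p) := by
    have hu : u = f * r * f - f := by rw [h₂.e_t_e]; abel
    have hv : v = e * q * e - e := by rw [h₁.e_t_e]; abel
    rw [hu, hv, mul_sub, sub_mul, ← c3, ← mul_assoc, ← mul_assoc, c3, mul_assoc e _ r, c2]
    simp only [mul_assoc] at c3 ⊢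
    rw [c3]
  have c5 : v * (r * q * p) = v := by
    rw [← mul_assoc, ← mul_assoc, four_v_r hx hm hθ hh h₁ h₂ h, h₁.v_t, h₁.v_s]
  rw [← c5, ← c4, mul_assoc, hp, mul_assoc, h₂.s_v, h₂.t_v]

end FourStrands
end Skein
-- The two sets of relations for families of units, and the rescaling by `a`.
section Presentations

variable {K D : Type*} [CommRing K] [Ring D] [Algebra K D]

/-- The element `e` attached to a unit `s`, where `y` stands for `x⁻¹`. -/
def idem (a y : K) (s : Dˣ) : D := a • (y • ((↑s⁻¹ : D) + s) - 1)

/-- The defining relations of `BMW_n^{††}`, for a family of units of an algebra. -/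
structure BMWData {n : ℕ} (a x : K) (s : Fin (n - 1) → Dˣ) : Prop where
  braid (i j : Fin (n - 1)) (h : (j : ℕ) = i + 1) : s i * s j * s i = s j * s i * s j
  comm (i j : Fin (n - 1)) (h : (i : ℕ) + 2 ≤ j) : s i * s j = s j * s i
  cubic (i : Fin (n - 1)) : ((s i : D) - algebraMap K D a) * ((s i : D) ^ 2 - x • (s i : D) + 1) = 0
  six (i j : Fin (n - 1)) (h : (j : ℕ) = i + 1) :
    -((s i * (s j)⁻¹ * s i : Dˣ) : D) + ((s j)⁻¹ * s i * (s j)⁻¹ : Dˣ) - (s i * s j * s i : Dˣ)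
      - x • (((s j)⁻¹ * (s j)⁻¹ : Dˣ) : D) + x • ((s i * s i : Dˣ) : D)
      + ((s j)⁻¹ * (s i)⁻¹ * (s j)⁻¹ : Dˣ) = 0

/-- The defining relations of `F_n`, for a family of units and an element of an algebra. -/
structure FData {n : ℕ} (a x y : K) (s : Fin (n - 1) → Dˣ) (C : D) : Prop where
  braid (i j : Fin (n - 1)) (h : (j : ℕ) = i + 1) : s i * s j * s i = s j * s i * s j
  comm (i j : Fin (n - 1)) (h : (i : ℕ) + 2 ≤ j) : s i * s j = s j * s i
  cubic (i : Fin (n - 1)) : ((s i : D) - algebraMap K D a) * ((s i : D) ^ 2 - x • (s i : D) + 1) = 0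
  e_s_e (i j : Fin (n - 1)) (h : (j : ℕ) = i + 1 ∨ (i : ℕ) = j + 1) :
    idem a y (s i) * s j * idem a y (s i) = idem a y (s i) + C
  e_sinv_e (i j : Fin (n - 1)) (h : (j : ℕ) = i + 1 ∨ (i : ℕ) = j + 1) :
    idem a y (s i) * (↑(s j)⁻¹ : D) * idem a y (s i) = idem a y (s i) + C
  s_mul_C (i : Fin (n - 1)) : s i * C = a • C
  C_mul_s (i : Fin (n - 1)) : C * s i = a • C

variable {a x y : K}

theorem smul_idem (hy : y * x = 1) (s : Dˣ) :
    x • idem a y s = a • ((↑s⁻¹ : D) + s - x • (1 : D)) := by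
  rw [idem, smul_comm x a, smul_sub x, smul_smul x y, mul_comm x y, hy, one_smul]

theorem mul_idem (hy : y * x = 1) {s : Dˣ}
    (hc : ((s : D) - algebraMap K D a) * ((s : D) ^ 2 - x • (s : D) + 1) = 0) :
    s * idem a y s = a • idem a y s := by
  have h1 : (s : D) ^ 2 - x • (s : D) + 1 = s * ((↑s⁻¹ : D) + s - x • (1 : D)) := by
    rw [mul_sub, mul_add, Units.mul_inv, mul_smul_comm, mul_one, sq]; abel
  have h2 : ((↑s⁻¹ : D) + s - x • (1 : D)) * s = s * ((↑s⁻¹ : D) + s - x • (1 : D)) := by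
    simp [mul_sub, sub_mul, mul_add, add_mul]
  have h3 : (s : D) * ((↑s⁻¹ : D) + s - x • (1 : D)) = a • ((↑s⁻¹ : D) + s - x • (1 : D)) := by
    rw [h1, ← h2, ← mul_assoc] at hc
    have h4 := congrArg (· * (↑s⁻¹ : D)) hc
    simp only [mul_assoc, Units.mul_inv, mul_one, zero_mul, sub_mul] at h4
    rw [sub_eq_zero] at h4
    rw [h4, Algebra.smul_def a]
  have h5 : idem a y s = (y * a) • ((↑s⁻¹ : D) + s - x • (1 : D)) := by
    rw [mul_smul, ← smul_idem hy, smul_smul, hy, one_smul]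
  rw [h5, mul_smul_comm, h3, smul_comm]

theorem idem_mul_comm (s : Dˣ) : idem a y s * s = s * idem a y s := by
  simp [idem, mul_sub, sub_mul, mul_add, add_mul]

/-- The rescaling to `a = 1`. The square of the idempotent comes from multiplying the skein relation
by it and dividing by `a x`. -/
theorem gen_smul (ha : a * a = 1) (hy : y * x = 1) {s : Dˣ}
    (hc : ((s : D) - algebraMap K D a) * ((s : D) ^ 2 - x • (s : D) + 1) = 0) :
    Gen (a * x) (2 * a * y) (a • (s : D)) (a • (↑s⁻¹ : D)) (a • idem a y s) := by
  have h1 : a • (s : D) * a • idem a y s = a • idem a y s := by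
    rw [smul_mul_smul_comm, ha, one_smul, mul_idem hy hc]
  have h2 : a • idem a y s * a • (s : D) = a • idem a y s := by
    rw [smul_mul_smul_comm, ha, one_smul, idem_mul_comm, mul_idem hy hc]
  have h3 : a • (↑s⁻¹ : D) = (a * x) • (1 : D) + (a * x) • (a • idem a y s) - a • (s : D) := by
    rw [smul_smul, mul_right_comm, ha, one_mul, smul_idem hy, ← smul_smul, ← smul_add, ← smul_sub]
    congr 1; abel
  have h4 : a • (s : D) * a • (↑s⁻¹ : D) = 1 := by
    rw [smul_mul_smul_comm, ha, one_smul, Units.mul_inv]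
  have h5 : a • (↑s⁻¹ : D) * a • (s : D) = 1 := by
    rw [smul_mul_smul_comm, ha, one_smul, Units.inv_mul]
  refine ⟨h4, h5, h3, h1, h2, ?_⟩
  set e := a • idem a y s
  have h6 : a • (↑s⁻¹ : D) * e = e := by
    calc _ = a • (↑s⁻¹ : D) * (a • (s : D) * e) := by rw [h1]
      _ = e := by rw [← mul_assoc, h5, one_mul]
  have h7 := congrArg (· * e) h3
  simp only [h6, sub_mul, add_mul, smul_mul_assoc (a * x), one_mul, h1] at h7
  have h8 : (a * y) • (a * x) • (e * e) = (a * y) • (2 • e - (a * x) • e) := by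
    congr 1
    linear_combination (norm := abel) h7.symm
  have h9 : a * y * (a * x) = 1 := by linear_combination y * x * ha + hy
  rw [smul_sub, smul_smul, smul_smul, h9, one_smul, one_smul, two_smul, smul_add, ← add_smul] at h8
  rw [h8]; congr 2; ring


theorem smul_smul_smul_mul (ha : a * a = 1) (p q r : D) :
    a • p * a • q * a • r = a • (p * q * r) := by
  rw [smul_mul_smul_comm, smul_mul_smul_comm, ha, one_mul]

theorem smul_conj_idem (ha : a * a = 1) (hy : y * x = 1) (s : Dˣ) (t : D) :
    x • (a • t * a • idem a y s * a • t) = t * ↑s⁻¹ * t + t * s * t - x • (t * t) := by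
  have h : x • (t * idem a y s * t) = t * (x • idem a y s) * t := by
    rw [mul_smul_comm, smul_mul_assoc]
  rw [smul_smul_smul_mul ha, smul_comm x a, h, smul_idem hy, mul_smul_comm, smul_mul_assoc,
    smul_smul, ha, one_smul]
  simp [mul_sub, sub_mul, mul_add, add_mul]

/-- Multiplying the difference of the two conjugated idempotents by `x` gives exactly the six-term
element, and `x` is a unit. -/
theorem six_iff (ha : a * a = 1) (hy : y * x = 1) (s t : Dˣ) :
    -((s * t⁻¹ * s : Dˣ) : D) + (t⁻¹ * s * t⁻¹ : Dˣ) - (s * t * s : Dˣ)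
      - x • ((t⁻¹ * t⁻¹ : Dˣ) : D) + x • ((s * s : Dˣ) : D) + (t⁻¹ * s⁻¹ * t⁻¹ : Dˣ) = 0 ↔
    a • (↑t⁻¹ : D) * a • idem a y s * a • (↑t⁻¹ : D) =
      a • (s : D) * a • idem a y t * a • (s : D) := by
  have h : ∀ p q : D, p = q ↔ x • p - x • q = 0 := fun p q => by
    refine ⟨fun h => by rw [h, sub_self], fun h => ?_⟩
    have := congrArg (y • ·) (sub_eq_zero.mp h)
    simpa only [smul_smul, hy, one_smul] using this
  rw [h (a • (↑t⁻¹ : D) * a • idem a y s * a • (↑t⁻¹ : D)), smul_conj_idem ha hy,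
    smul_conj_idem ha hy]
  simp only [Units.val_mul]
  constructor <;> intro h1 <;> rw [← h1] <;> abel

theorem smul_braid {s t : Dˣ} (h : s * t * s = t * s * t) :
    a • (s : D) * a • (t : D) * a • (s : D) = a • (t : D) * a • (s : D) * a • (t : D) := by
  simp only [smul_mul_smul_comm]
  congr 1
  exact congrArg Units.val h

theorem smul_relation_iff (ha : a * a = 1) (e t C : D) :
    e * t * e = e + C ↔ a • e * a • t * a • e = a • e + a • C := by
  rw [smul_smul_smul_mul ha, ← smul_add]
  refine ⟨fun h => by rw [h], fun h => ?_⟩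
  have := congrArg (a • ·) h
  simpa only [smul_smul, ha, one_smul] using this

theorem smul_fixed_iff (ha : a * a = 1) (s C : D) : s * C = a • C ↔ a • s * a • C = a • C := by
  rw [smul_mul_smul_comm, ha, one_smul]

theorem smul_fixed_iff' (ha : a * a = 1) (s C : D) : C * s = a • C ↔ a • C * a • s = a • C := by
  rw [smul_mul_smul_comm, ha, one_smul]

variable {n : ℕ} {s : Fin (n - 1) → Dˣ}

theorem FData.adj (ha : a * a = 1) (hy : y * x = 1) {C : D} (h : FData a x y s C)
    (i j : Fin (n - 1)) (hij : (j : ℕ) = i + 1) :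
    Adj (a * x) (2 * a * y) (a • (s i : D)) (a • (↑(s i)⁻¹ : D)) (a • idem a y (s i))
      (a • (s j : D)) (a • (↑(s j)⁻¹ : D)) (a • idem a y (s j)) (a • C) where
  left := gen_smul ha hy (h.cubic i)
  right := gen_smul ha hy (h.cubic j)
  braid := smul_braid (h.braid i j hij)
  e_t_e := (smul_relation_iff ha _ _ _).mp (h.e_s_e i j (.inl hij))
  e_T_e := (smul_relation_iff ha _ _ _).mp (h.e_sinv_e i j (.inl hij))
  f_s_f := (smul_relation_iff ha _ _ _).mp (h.e_s_e j i (.inr hij))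
  f_S_f := (smul_relation_iff ha _ _ _).mp (h.e_sinv_e j i (.inr hij))
  s_v := (smul_fixed_iff ha _ _).mp (h.s_mul_C i)
  v_s := (smul_fixed_iff' ha _ _).mp (h.C_mul_s i)
  t_v := (smul_fixed_iff ha _ _).mp (h.s_mul_C j)
  v_t := (smul_fixed_iff' ha _ _).mp (h.C_mul_s j)

theorem FData.bmwData (ha : a * a = 1) (hy : y * x = 1) {C : D} (h : FData a x y s C) :
    BMWData a x s where
  braid := h.braid
  comm := h.comm
  cubic := h.cubic
  six i j hij := by
    have hx : a * y * (a * x) = 1 := by linear_combination y * x * ha + hy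
    exact (six_iff ha hy (s i) (s j)).mpr ((h.adj ha hy i j hij).six hx)

/-- The relations of `BMW_n^{††}` imply those of `F_n` once `x + 2a` is invertible. -/
theorem BMWData.exists_fData (hn : 3 ≤ n) (ha : a * a = 1) (hy : y * x = 1)
    (h2 : IsUnit (2 : K)) (hxa : IsUnit (x + 2 * a)) (h : BMWData a x s) :
    ∃ C : D, FData a x y s C := by
  obtain ⟨θ, hθ⟩ := hxa.exists_left_inv
  have hx : a * y * (a * x) = 1 := by linear_combination y * x * ha + hy
  have hm : a * x * (2 * a * y) = 2 := by linear_combination 2 * x * y * ha + 2 * hy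
  -- After rescaling, `2 + x` becomes `2 + a x = a (x + 2a)`.
  have hθ' : θ * a * (2 + a * x) = 1 := by linear_combination hθ + θ * x * ha
  let c (i j : Fin (n - 1)) : D :=
    a • idem a y (s i) * a • (s j : D) * a • idem a y (s i) - a • idem a y (s i)
  have adj (i j : Fin (n - 1)) (hij : (j : ℕ) = i + 1) :
      Adj (a * x) (2 * a * y) (a • (s i : D)) (a • (↑(s i)⁻¹ : D)) (a • idem a y (s i))
        (a • (s j : D)) (a • (↑(s j)⁻¹ : D)) (a • idem a y (s j)) (c i j) :=
    Adj.of_six hx hm (gen_smul ha hy (h.cubic i)) (gen_smul ha hy (h.cubic j))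
      (smul_braid (h.braid i j hij)) ((six_iff ha hy (s i) (s j)).mp (h.six i j hij))
  have hc (k : ℕ) (hk : k + 1 < n - 1) :
      c ⟨k, by omega⟩ ⟨k + 1, hk⟩ = c ⟨0, by omega⟩ ⟨1, by omega⟩ := by
    induction k with
    | zero => rfl
    | succ k ih =>
      rw [← ih (by omega)]
      have hcomm := congrArg Units.val (h.comm ⟨k, by omega⟩ ⟨k + 1 + 1, hk⟩ le_rfl)
      refine (four_eq hx hm hθ' h2 (adj ⟨k, by omega⟩ ⟨k + 1, by omega⟩ rfl)
        (adj ⟨k + 1, by omega⟩ ⟨k + 1 + 1, hk⟩ rfl) ?_).symm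
      rw [smul_mul_smul_comm, smul_mul_smul_comm]
      exact congrArg _ hcomm
  set v := c ⟨0, by omega⟩ ⟨1, by omega⟩
  -- The element `C` will be `a v`, whose rescaling is `a (a v) = v`.
  have adj' (i j : Fin (n - 1)) (hij : (j : ℕ) = i + 1) :
      Adj (a * x) (2 * a * y) (a • (s i : D)) (a • (↑(s i)⁻¹ : D)) (a • idem a y (s i))
        (a • (s j : D)) (a • (↑(s j)⁻¹ : D)) (a • idem a y (s j)) (a • a • v) := by
    obtain ⟨i, hi⟩ := i
    obtain ⟨j, hj⟩ := j
    obtain rfl : j = i + 1 := hij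
    have h1 := adj ⟨i, hi⟩ ⟨i + 1, hj⟩ rfl
    rw [hc i hj] at h1
    rwa [smul_smul, ha, one_smul]
  have adj'' (i j : Fin (n - 1)) (hij : (j : ℕ) = i + 1 ∨ (i : ℕ) = j + 1) :
      Adj (a * x) (2 * a * y) (a • (s i : D)) (a • (↑(s i)⁻¹ : D)) (a • idem a y (s i))
        (a • (s j : D)) (a • (↑(s j)⁻¹ : D)) (a • idem a y (s j)) (a • a • v) :=
    hij.elim (adj' i j) fun hij => (adj' j i hij).swap
  -- The relations between `s_i` and `C` come from an adjacent pair containing `i`, which exists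
  -- because `n ≥ 3`.
  have nbr (i : Fin (n - 1)) : ∃ j : Fin (n - 1), (j : ℕ) = i + 1 ∨ (i : ℕ) = j + 1 := by
    rcases Nat.eq_zero_or_pos i with hi | hi
    · exact ⟨⟨i + 1, by omega⟩, .inl rfl⟩
    · exact ⟨⟨i - 1, by omega⟩, .inr (by simp only; omega)⟩
  refine ⟨a • v, h.braid, h.comm, h.cubic, fun i j hij => ?_, fun i j hij => ?_, fun i => ?_,
    fun i => ?_⟩
  · exact (smul_relation_iff ha _ _ _).mpr (adj'' i j hij).e_t_e
  · exact (smul_relation_iff ha _ _ _).mpr (adj'' i j hij).e_T_e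
  · obtain ⟨j, hj⟩ := nbr i
    exact (smul_fixed_iff ha _ _).mpr (adj'' i j hj).s_v
  · obtain ⟨j, hj⟩ := nbr i
    exact (smul_fixed_iff' ha _ _).mpr (adj'' i j hj).v_s

section Functoriality

variable {D' : Type*} [Ring D'] [Algebra K D']

theorem map_idem (f : D →ₐ[K] D') (s : Dˣ) :
    f (idem a y s) = idem a y (Units.map (f : D →* D') s) := by
  simp [idem]

theorem BMWData.map (h : BMWData a x s) (f : D →ₐ[K] D') :
    BMWData a x (fun i => Units.map (f : D →* D') (s i)) where
  braid i j hij := by simp only [← map_mul, h.braid i j hij]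
  comm i j hij := by simp only [← map_mul, h.comm i j hij]
  cubic i := by simpa using congrArg f (h.cubic i)
  six i j hij := by simpa using congrArg f (h.six i j hij)

theorem FData.map {C : D} (h : FData a x y s C) (f : D →ₐ[K] D') :
    FData a x y (fun i => Units.map (f : D →* D') (s i)) (f C) where
  braid i j hij := by simp only [← map_mul, h.braid i j hij]
  comm i j hij := by simp only [← map_mul, h.comm i j hij]
  cubic i := by simpa using congrArg f (h.cubic i)
  e_s_e i j hij := by simpa [map_idem] using congrArg f (h.e_s_e i j hij)
  e_sinv_e i j hij := by simpa [map_idem] using congrArg f (h.e_sinv_e i j hij)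
  s_mul_C i := by simpa using congrArg f (h.s_mul_C i)
  C_mul_s i := by simpa using congrArg f (h.C_mul_s i)

variable {L : Type*} [CommRing L] [Algebra K L] [Algebra L D] [IsScalarTower K L D]

theorem idem_algebraMap (s : Dˣ) : idem (algebraMap K L a) (algebraMap K L y) s = idem a y s := by
  simp [idem]

theorem BMWData.algebraMap_iff :
    BMWData (algebraMap K L a) (algebraMap K L x) s ↔ BMWData a x s := by
  constructor <;> intro h <;> refine ⟨h.braid, h.comm, fun i => ?_, fun i j hij => ?_⟩
  · simpa [← IsScalarTower.algebraMap_apply K L D] using h.cubic i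
  · simpa using h.six i j hij
  · simpa [← IsScalarTower.algebraMap_apply K L D] using h.cubic i
  · simpa using h.six i j hij

theorem FData.algebraMap_iff {C : D} :
    FData (algebraMap K L a) (algebraMap K L x) (algebraMap K L y) s C ↔ FData a x y s C := by
  constructor <;> intro h <;> refine ⟨h.braid, h.comm, fun i => ?_, fun i j hij => ?_,
    fun i j hij => ?_, fun i => ?_, fun i => ?_⟩
  · simpa [← IsScalarTower.algebraMap_apply K L D] using h.cubic i
  · simpa only [idem_algebraMap] using h.e_s_e i j hij
  · simpa only [idem_algebraMap] using h.e_sinv_e i j hij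
  · simpa using h.s_mul_C i
  · simpa using h.C_mul_s i
  · simpa [← IsScalarTower.algebraMap_apply K L D] using h.cubic i
  · simpa only [idem_algebraMap] using h.e_s_e i j hij
  · simpa only [idem_algebraMap] using h.e_sinv_e i j hij
  · simpa using h.s_mul_C i
  · simpa using h.C_mul_s i

end Functoriality

end Presentations
-- Specialization of parameters and base change to `S^{††}`.
noncomputable section

/-- The inverse of `x` in `S^{††}`. -/
def ddXInv : Sdd := algebraMap A Sdd AxInv

theorem algebraMap_Aa : algebraMap A Sdd Aa = ddA :=
  (A₀ToSdd_algebraMap _).trans polyToSdd_X0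

theorem algebraMap_Ax : algebraMap A Sdd Ax = ddX :=
  (A₀ToSdd_algebraMap _).trans polyToSdd_X1

theorem ddXInv_mul_ddX : ddXInv * ddX = 1 := by
  rw [ddXInv, ← algebraMap_Ax, ← map_mul, mul_comm, Ax_mul_AxInv, map_one]

theorem dd_bc : algebraMap R Sdd (Rb * Rc) = 1 := by
  have h : mkSdd (algebraMap R S (Rb * Rc - 1)) = 0 :=
    Ideal.Quotient.eq_zero_iff_mem.mpr (Ideal.subset_span (by simp))
  have h2 : algebraMap R Sdd (Rb * Rc - 1) = 0 := h
  rw [map_sub, map_one] at h2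
  exact sub_eq_zero.mp h2

theorem isUnit_two_Sdd : IsUnit (2 : Sdd) := by
  have h := (IsUnit.mk0 (2 : ℚ) two_ne_zero).map (polyToSdd.comp MvPolynomial.C)
  rwa [map_ofNat] at h

section BaseChange

variable {K L P D : Type*} [CommSemiring K] [CommSemiring L] [Algebra K L] [Semiring P]
  [Algebra K P] [Semiring D] [Algebra K D] [Algebra L D] [IsScalarTower K L D]

/-- The extension of an algebra morphism along a base change. -/
def extend (f : P →ₐ[K] D) : L ⊗[K] P →ₐ[L] D :=
  Algebra.TensorProduct.lift (Algebra.ofId L D) f fun r z => Algebra.commutes r (f z)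

theorem extend_one_tmul (f : P →ₐ[K] D) (z : P) : extend (L := L) f (1 ⊗ₜ[K] z) = f z := by
  calc extend f (1 ⊗ₜ[K] z) = algebraMap L D 1 * f z := rfl
    _ = f z := by rw [map_one, one_mul]

end BaseChange

section Specialize

variable {D : Type*} [Ring D] [Algebra Sdd D] [Algebra R D] [IsScalarTower R Sdd D]

theorem cubic_eq (s : D) :
    (s - algebraMap R D Ra) * (s - algebraMap R D Rb) * (s - algebraMap R D Rc) =
      (s - algebraMap Sdd D ddA) * (s ^ 2 - ddX • s + 1) := by
  have ha : algebraMap R D Ra = algebraMap Sdd D ddA := IsScalarTower.algebraMap_apply R Sdd D Ra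
  have hbc : algebraMap R D Rb * algebraMap R D Rc = 1 := by
    rw [← map_mul, IsScalarTower.algebraMap_apply R Sdd D, dd_bc, map_one]
  have hx : ddX • s = algebraMap R D Rb * s + s * algebraMap R D Rc := by
    rw [ddX, algebraMap_smul, Algebra.smul_def, map_add, add_mul, Algebra.commutes Rc s]
  rw [ha, mul_assoc, hx]
  congr 1
  rw [sub_mul, mul_sub, mul_sub, hbc, sq]
  abel

theorem six_eq (p₁ p₂ p₃ p₄ p₅ p₆ : D) :
    -((Rb * Rc) • p₁) + (Rb * Rc) ^ 2 • p₂ - p₃ - ((Rb + Rc) * (Rb * Rc) ^ 2) • p₄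
      + (Rb + Rc) • p₅ + (Rb * Rc) ^ 3 • p₆ = -p₁ + p₂ - p₃ - ddX • p₄ + ddX • p₅ + p₆ := by
  simp only [← algebraMap_smul Sdd (_ : R) (_ : D), map_mul (algebraMap R Sdd) (Rb + Rc),
    map_pow, dd_bc, one_pow, one_smul, mul_one]
  rfl

end Specialize

/-! ### The universal property of `BMW_n^{††}`. -/

section BMW

variable {n : ℕ}

/-- A braid, as a unit of `BMW_n^{††}`. -/
def braidUnit : Braid n →* (BMWdd n)ˣ :=
  MonoidHom.toHomUnits
    ((((Algebra.TensorProduct.includeRight : BMWt n →ₐ[R] BMWdd n).comp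
      ((RingQuot.mkAlgHom R (SixTermRel n)).comp (RingQuot.mkAlgHom R (CubicRel n)))) :
        MonoidAlgebra R (Braid n) →* BMWdd n).comp (MonoidAlgebra.of R (Braid n)))

theorem algHom_ext_BMWdd {D : Type*} [Ring D] [Algebra Sdd D] {f g : BMWdd n →ₐ[Sdd] D}
    (h : ∀ i : Fin (n - 1), f (1 ⊗ₜ[R] BMWt.s i) = g (1 ⊗ₜ[R] BMWt.s i)) : f = g := by
  let _ : Algebra R D := Algebra.compHom D (algebraMap R Sdd)
  have : IsScalarTower R Sdd D := IsScalarTower.of_algebraMap_eq' rfl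
  -- Passing to units makes the maps group homomorphisms, so agreement on the Artin generators
  -- extends to inverses.
  have h1 : (Units.map (f : BMWdd n →* D)).comp braidUnit =
      (Units.map (g : BMWdd n →* D)).comp braidUnit :=
    PresentedGroup.ext fun i => Units.ext (h i)
  refine Algebra.TensorProduct.ext (Subsingleton.elim _ _) ?_
  refine RingQuot.ringQuot_ext' _ _ _ (RingQuot.ringQuot_ext' _ _ _ ?_)
  refine MonoidAlgebra.algHom_ext' ?_ (Subsingleton.elim _ _)
  ext w
  exact congrArg Units.val (DFunLike.congr_fun h1 w)

theorem bmwData_BMWdd : BMWData ddA ddX fun i : Fin (n - 1) => (braidUnit (σ i) : (BMWdd n)ˣ) where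
  braid i j h := by
    simp only [← map_mul]
    congr 1
    exact mul_inv_eq_one.mp (PresentedGroup.one_of_mem (BraidRel.braid i j h))
  comm i j h := by
    simp only [← map_mul]
    congr 1
    exact mul_inv_eq_one.mp (PresentedGroup.one_of_mem (BraidRel.comm i j h))
  cubic i := by
    rw [← cubic_eq]
    have h := congrArg ((Algebra.TensorProduct.includeRight : BMWt n →ₐ[R] BMWdd n).comp
      (RingQuot.mkAlgHom R (SixTermRel n))) (RingQuot.mkAlgHom_rel R (CubicRel.cubic i))
    simp only [map_mul, map_sub, AlgHom.commutes, map_zero] at h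
    exact h
  six i j h := by
    rw [← six_eq]
    have h := congrArg (Algebra.TensorProduct.includeRight : BMWt n →ₐ[R] BMWdd n)
      (RingQuot.mkAlgHom_rel R (SixTermRel.six i j h))
    simp only [sixTerm, map_add, map_sub, map_neg, map_smul, map_zero] at h
    simp only [← map_mul, ← map_inv]
    exact h

section Lift

variable {D : Type*} [Ring D] [Algebra Sdd D] {s : Fin (n - 1) → Dˣ}

/-- The representation of the braid group attached to a family of units with the relations of
`BMW_n^{††}`. -/
def BMWData.braidHom (h : BMWData ddA ddX s) : Braid n →* Dˣ :=
  PresentedGroup.toGroup (f := s) (by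
    rintro _ (⟨i, j, hij⟩ | ⟨i, j, hij⟩)
    · rw [map_mul, map_inv, mul_inv_eq_one]
      simpa using h.braid i j hij
    · rw [map_mul, map_inv, mul_inv_eq_one]
      simpa using h.comm i j hij)

theorem BMWData.braidHom_σ (h : BMWData ddA ddX s) (i : Fin (n - 1)) : h.braidHom (σ i) = s i :=
  PresentedGroup.toGroup.of _

/-- The universal property of `BMW_n^{††}`. -/
theorem BMWData.exists_algHom (h : BMWData ddA ddX s) :
    ∃ f : BMWdd n →ₐ[Sdd] D, ∀ i : Fin (n - 1), f (1 ⊗ₜ[R] BMWt.s i) = s i := by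
  let _ : Algebra R D := Algebra.compHom D (algebraMap R Sdd)
  have : IsScalarTower R Sdd D := IsScalarTower.of_algebraMap_eq' rfl
  let f₀ : MonoidAlgebra R (Braid n) →ₐ[R] D :=
    MonoidAlgebra.lift R D (Braid n) ((Units.coeHom D).comp h.braidHom)
  have hf₀ (w : Braid n) : f₀ (ofBraid w) = h.braidHom w :=
    MonoidAlgebra.lift_of _ _
  have hc : ∀ ⦃p q⦄, CubicRel n p q → f₀ p = f₀ q := by
    rintro _ _ ⟨i⟩
    simp only [map_mul, map_sub, AlgHom.commutes, map_zero, hf₀, h.braidHom_σ]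
    rw [cubic_eq, h.cubic i]
  let f₁ : H n →ₐ[R] D := RingQuot.liftAlgHom R ⟨f₀, hc⟩
  have hf₁ (w : Braid n) : f₁ (H.braid w) = h.braidHom w :=
    (RingQuot.liftAlgHom_mkAlgHom_apply R _ hc _).trans (hf₀ w)
  have h6 : ∀ ⦃p q⦄, SixTermRel n p q → f₁ p = f₁ q := by
    rintro _ _ ⟨i, j, hij⟩
    simp only [sixTerm, map_add, map_sub, map_neg, map_smul, map_zero, hf₁]
    rw [six_eq]
    simpa only [map_mul, map_inv, h.braidHom_σ] using h.six i j hij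
  let f₂ : BMWt n →ₐ[R] D := RingQuot.liftAlgHom R ⟨f₁, h6⟩
  refine ⟨extend f₂, fun i => ?_⟩
  rw [extend_one_tmul, ← h.braidHom_σ, ← hf₁]
  exact RingQuot.liftAlgHom_mkAlgHom_apply R _ h6 _

end Lift

end BMW

/-! ### The universal property of `F_n` and of its base change. -/

section FAlgebra

variable {n : ℕ}

/-- The generators `s_i` of `F_n`, as units. -/
def F.unit (i : Fin (n - 1)) : (F n)ˣ where
  val := F.s i
  inv := RingQuot.mkAlgHom A (FRel n) (fsi i)
  val_inv := by
    rw [F.s, ← map_mul, RingQuot.mkAlgHom_rel A (FRel.mul_inv i), map_one]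
  inv_val := by
    rw [F.s, ← map_mul, RingQuot.mkAlgHom_rel A (FRel.inv_mul i), map_one]

theorem mkAlgHom_fs (i : Fin (n - 1)) : RingQuot.mkAlgHom A (FRel n) (fs i) = F.unit i := rfl

theorem mkAlgHom_fsi (i : Fin (n - 1)) :
    RingQuot.mkAlgHom A (FRel n) (fsi i) = ↑(F.unit i)⁻¹ := rfl

theorem mkAlgHom_fe (i : Fin (n - 1)) :
    RingQuot.mkAlgHom A (FRel n) (fe i) = idem Aa AxInv (F.unit i) := by
  rw [RingQuot.mkAlgHom_rel A (FRel.e_def i)]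
  simp only [map_smul, map_sub, map_add, map_one]
  rfl

theorem fData_F : FData Aa Ax AxInv (F.unit (n := n)) (RingQuot.mkAlgHom A (FRel n) (fC n)) where
  braid i j h := Units.ext (by
    simpa only [map_mul, mkAlgHom_fs, mkAlgHom_fsi, Units.val_mul] using
      RingQuot.mkAlgHom_rel A (FRel.braid i j h))
  comm i j h := Units.ext (by
    simpa only [map_mul, mkAlgHom_fs, mkAlgHom_fsi, Units.val_mul] using
      RingQuot.mkAlgHom_rel A (FRel.comm i j h))
  cubic i := by
    simpa only [map_mul, map_sub, map_add, map_pow, map_smul, map_one, map_zero,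
      AlgHom.commutes, mkAlgHom_fs, mkAlgHom_fsi]
      using RingQuot.mkAlgHom_rel A (FRel.cubic i)
  e_s_e i j h := by
    simpa only [map_mul, map_add, mkAlgHom_fe, mkAlgHom_fs, mkAlgHom_fsi, Units.val_mul] using
      RingQuot.mkAlgHom_rel A (FRel.e_s_e i j h)
  e_sinv_e i j h := by
    simpa only [map_mul, map_add, mkAlgHom_fe, mkAlgHom_fs, mkAlgHom_fsi, Units.val_mul] using
      RingQuot.mkAlgHom_rel A (FRel.e_sinv_e i j h)
  s_mul_C i := by
    simpa only [map_mul, map_smul, mkAlgHom_fs, mkAlgHom_fsi, Units.val_mul] using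
      RingQuot.mkAlgHom_rel A (FRel.s_mul_C i)
  C_mul_s i := by
    simpa only [map_mul, map_smul, mkAlgHom_fs, mkAlgHom_fsi, Units.val_mul] using
      RingQuot.mkAlgHom_rel A (FRel.C_mul_s i)

/-- The generators `s_i` of `F_n ⊗_A S^{††}`, as units. -/
def Fdd.unit (i : Fin (n - 1)) : (Fdd n)ˣ :=
  Units.map ((Algebra.TensorProduct.includeRight : F n →ₐ[A] Fdd n) : F n →* Fdd n) (F.unit i)

theorem fData_Fdd : ∃ C : Fdd n, FData ddA ddX ddXInv Fdd.unit C := by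
  rw [← algebraMap_Aa, ← algebraMap_Ax, ddXInv]
  exact ⟨_, FData.algebraMap_iff.mpr (fData_F.map (D' := Fdd n) Algebra.TensorProduct.includeRight)⟩

/-- Algebra morphisms out of `F_n` are determined by the images of the `s_i`. -/
theorem algHom_ext_F (hn : 3 ≤ n) {D : Type*} [Ring D] [Algebra A D] {f g : F n →ₐ[A] D}
    (h : ∀ i : Fin (n - 1), f (F.s i) = g (F.s i)) : f = g := by
  have hu (i : Fin (n - 1)) : Units.map (f : F n →* D) (F.unit i) =
      Units.map (g : F n →* D) (F.unit i) := Units.ext (h i)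
  have he (i : Fin (n - 1)) : f (idem Aa AxInv (F.unit i)) = g (idem Aa AxInv (F.unit i)) := by
    rw [map_idem, map_idem, hu]
  refine RingQuot.ringQuot_ext' _ _ _ (FreeAlgebra.hom_ext (funext fun w => ?_))
  cases w with
  | s i => exact h i
  | sinv i => exact congrArg (fun u : Dˣ => (↑u⁻¹ : D)) (hu i)
  | e i =>
    have := he i
    rwa [← mkAlgHom_fe] at this
  | C =>
    -- With at least two generators, `C = e_1 s_2 e_1 - e_1` is determined by the `s_i`.
    have h1 := fData_F.e_s_e (n := n) ⟨0, by omega⟩ ⟨1, by omega⟩ (.inl rfl)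
    have h2 := congrArg f h1
    have h3 := congrArg g h1
    rw [map_mul, map_mul, map_add, he] at h2
    rw [map_mul, map_mul, map_add] at h3
    have h4 : f (F.unit (⟨1, by omega⟩ : Fin (n - 1))) =
      g (F.unit (⟨1, by omega⟩ : Fin (n - 1))) := h _
    rw [h4, h3] at h2
    exact (add_left_cancel h2).symm

theorem algHom_ext_Fdd (hn : 3 ≤ n) {D : Type*} [Ring D] [Algebra Sdd D] {f g : Fdd n →ₐ[Sdd] D}
    (h : ∀ i : Fin (n - 1), f (1 ⊗ₜ[A] F.s i) = g (1 ⊗ₜ[A] F.s i)) : f = g := by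
  let _ : Algebra A D := Algebra.compHom D (algebraMap A Sdd)
  have : IsScalarTower A Sdd D := IsScalarTower.of_algebraMap_eq' rfl
  exact Algebra.TensorProduct.ext (Subsingleton.elim _ _) (algHom_ext_F hn h)

section Lift

variable {D : Type*} [Ring D] [Algebra A D] {s : Fin (n - 1) → Dˣ} {C : D}

/-- The universal property of `F_n`. -/
theorem FData.exists_algHom_F (h : FData Aa Ax AxInv s C) :
    ∃ f : F n →ₐ[A] D, ∀ i : Fin (n - 1), f (F.s i) = s i := by
  let f₀ : FreeAlgebra A (FGen n) →ₐ[A] D := FreeAlgebra.lift A fun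
    | .s i => s i
    | .sinv i => ↑(s i)⁻¹
    | .e i => idem Aa AxInv (s i)
    | .C => C
  have hs (i : Fin (n - 1)) : f₀ (fs i) = s i := FreeAlgebra.lift_ι_apply _ _
  have hsi (i : Fin (n - 1)) : f₀ (fsi i) = ↑(s i)⁻¹ := FreeAlgebra.lift_ι_apply _ _
  have he (i : Fin (n - 1)) : f₀ (fe i) = idem Aa AxInv (s i) := FreeAlgebra.lift_ι_apply _ _
  have hC : f₀ (fC n) = C := FreeAlgebra.lift_ι_apply _ _
  have hr : ∀ ⦃p q⦄, FRel n p q → f₀ p = f₀ q := by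
    rintro _ _ (i | i | ⟨i, j, hij⟩ | ⟨i, j, hij⟩ | i | i | i | ⟨i, j, hij⟩ | ⟨i, j, hij⟩
      | i | i) <;>
      simp only [map_mul, map_sub, map_add, map_pow, map_smul, map_one, map_zero, AlgHom.commutes,
        hs, hsi, he, hC]
    · exact (s i).mul_inv
    · exact (s i).inv_mul
    · exact congrArg Units.val (h.braid i j hij)
    · exact congrArg Units.val (h.comm i j hij)
    · exact h.cubic i
    · rfl
    · exact mul_idem (by rw [mul_comm, Ax_mul_AxInv]) (h.cubic i)
    · exact h.e_s_e i j hij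
    · exact h.e_sinv_e i j hij
    · exact h.s_mul_C i
    · exact h.C_mul_s i
  exact ⟨RingQuot.liftAlgHom A ⟨f₀, hr⟩, fun i =>
    (RingQuot.liftAlgHom_mkAlgHom_apply A _ hr _).trans (hs i)⟩

end Lift

/-- The universal property of `F_n ⊗_A S^{††}`. -/
theorem FData.exists_algHom {D : Type*} [Ring D] [Algebra Sdd D] {s : Fin (n - 1) → Dˣ} {C : D}
    (h : FData ddA ddX ddXInv s C) :
    ∃ f : Fdd n →ₐ[Sdd] D, ∀ i : Fin (n - 1), f (1 ⊗ₜ[A] F.s i) = s i := by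
  let _ : Algebra A D := Algebra.compHom D (algebraMap A Sdd)
  have : IsScalarTower A Sdd D := IsScalarTower.of_algebraMap_eq' rfl
  rw [← algebraMap_Aa, ← algebraMap_Ax, ddXInv, FData.algebraMap_iff] at h
  obtain ⟨f, hf⟩ := h.exists_algHom_F
  exact ⟨extend f, fun i => (extend_one_tmul f _).trans (hf i)⟩

end FAlgebra

end

end CubicBMW

/-! ### Existence and uniqueness of the morphism, and its inverse after localization. -/

theorem mainTheorem1 (n : ℕ) (hn : 3 ≤ n) :
    (∃! φ : CubicBMW.BMWdd n →ₐ[CubicBMW.Sdd] CubicBMW.Fdd n,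
      ∀ i : Fin (n - 1), φ (1 ⊗ₜ[CubicBMW.R] CubicBMW.BMWt.s i) =
        1 ⊗ₜ[CubicBMW.A] CubicBMW.F.s i) ∧
    ∀ φ : CubicBMW.BMWdd n →ₐ[CubicBMW.Sdd] CubicBMW.Fdd n,
      (∀ i : Fin (n - 1), φ (1 ⊗ₜ[CubicBMW.R] CubicBMW.BMWt.s i) =
        1 ⊗ₜ[CubicBMW.A] CubicBMW.F.s i) →
      Function.Bijective
        (Algebra.TensorProduct.map (AlgHom.id CubicBMW.SddLoc CubicBMW.SddLoc) φ :
          CubicBMW.SddLoc ⊗[CubicBMW.Sdd] CubicBMW.BMWdd n →ₐ[CubicBMW.SddLoc]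
            CubicBMW.SddLoc ⊗[CubicBMW.Sdd] CubicBMW.Fdd n) := by
  open CubicBMW in
  have hA : ddA * ddA = 1 := by rw [← sq, ddA_sq]
  constructor
  · obtain ⟨C, hC⟩ := fData_Fdd (n := n)
    obtain ⟨φ, hφ⟩ := (hC.bmwData hA ddXInv_mul_ddX).exists_algHom
    exact ⟨φ, hφ, fun ψ hψ => algHom_ext_BMWdd fun i => (hψ i).trans (hφ i).symm⟩
  · intro φ hφ
    let ι : BMWdd n →ₐ[Sdd] SddLoc ⊗[Sdd] BMWdd n := Algebra.TensorProduct.includeRight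
    let a : SddLoc := algebraMap Sdd SddLoc ddA
    let x : SddLoc := algebraMap Sdd SddLoc ddX
    have ha : a * a = 1 := by rw [← map_mul, hA, map_one]
    have hy : algebraMap Sdd SddLoc ddXInv * x = 1 := by
      rw [← map_mul, ddXInv_mul_ddX, map_one]
    have h2 : IsUnit (2 : SddLoc) := by
      simpa only [map_ofNat] using isUnit_two_Sdd.map (algebraMap Sdd SddLoc)
    have hxa : IsUnit (x + 2 * a) := by
      have h := IsLocalization.Away.algebraMap_isUnit (S := SddLoc) (ddX + 2 * ddA)
      rwa [map_add, map_mul, map_ofNat] at h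
    -- `C` is found over the localized ring; the relations are then read over `S^{††}`, where the
    -- universal property of `F_n ⊗ S^{††}` applies.
    obtain ⟨C, hC⟩ := BMWData.exists_fData hn ha hy h2 hxa
      (BMWData.algebraMap_iff.mpr (bmwData_BMWdd.map (D' := SddLoc ⊗[Sdd] BMWdd n) ι))
    obtain ⟨ψ, hψ⟩ := (FData.algebraMap_iff.mp hC).exists_algHom
    let Ψ : SddLoc ⊗[Sdd] Fdd n →ₐ[SddLoc] SddLoc ⊗[Sdd] BMWdd n := extend ψ
    let Φ : SddLoc ⊗[Sdd] BMWdd n →ₐ[SddLoc] SddLoc ⊗[Sdd] Fdd n :=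
      Algebra.TensorProduct.map (AlgHom.id SddLoc SddLoc) φ
    have hΨ (z : Fdd n) : Ψ (1 ⊗ₜ[Sdd] z) = ψ z := extend_one_tmul ψ z
    have hΦ (z : BMWdd n) : Φ (1 ⊗ₜ[Sdd] z) = 1 ⊗ₜ[Sdd] φ z := rfl
    have hψ' (i : Fin (n - 1)) : ψ (1 ⊗ₜ[A] F.s i) = 1 ⊗ₜ[Sdd] (1 ⊗ₜ[R] BMWt.s i) := hψ i
    have h1 : Ψ.comp Φ = AlgHom.id _ _ := by
      refine Algebra.TensorProduct.ext (Subsingleton.elim _ _) ?_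
      refine algHom_ext_BMWdd (D := SddLoc ⊗[Sdd] BMWdd n) fun i => ?_
      change Ψ (Φ (1 ⊗ₜ[Sdd] (1 ⊗ₜ[R] BMWt.s i))) = 1 ⊗ₜ[Sdd] (1 ⊗ₜ[R] BMWt.s i)
      rw [hΦ, hφ, hΨ, hψ']
    have h2 : Φ.comp Ψ = AlgHom.id _ _ := by
      refine Algebra.TensorProduct.ext (Subsingleton.elim _ _) ?_
      refine algHom_ext_Fdd hn (D := SddLoc ⊗[Sdd] Fdd n) fun i => ?_
      change Φ (Ψ (1 ⊗ₜ[Sdd] (1 ⊗ₜ[A] F.s i))) = 1 ⊗ₜ[Sdd] (1 ⊗ₜ[A] F.s i)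
      rw [hΨ, hψ', hΦ, hφ]
    exact Function.bijective_iff_has_inverse.mpr
      ⟨Ψ, fun z => DFunLike.congr_fun h1 z, fun z => DFunLike.congr_fun h2 z⟩
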